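/- **Language.** Fix a set of propositional variables and a set of atomic games. Game terms are $G ::= g \mid G+G \mid G\times G \mid -G \mid G\circ G$ ($g$ an atomic game). Formulas are $\varphi ::= p \mid \bot \mid \neg\varphi \mid \varphi\wedge\varphi \mid [G,P](\Psi;\varphi)$, with $P\in\{\mathtt A,\mathtt B\}$ and $\Psi$ a finite set of formulas; $\top,\vee,\to,\leftrightarrow$ are the usual abbreviations, $\overline P$ is the opponent of $P$, and $[G,P]\varphi$ stands for $[G,P](\emptyset;\varphi)$. **Semantics.** An *instantial game model* consists of a set $W$, a valuation $V$ of the variables by subsets of $W$, and a relation $R_g^P\subseteq W\times\mathcal P(W)$ for each atomic game $g$ and player $P$, such that for all $u\in W$: - Non-emptiness: $R_g^P[u]\neq\emptyset$; - Instantiatedness: if $x\in Z\in R_g^P[u]$, then $x\in Z'$ for some $Z'\in R_g^{\overline P}[u]$; - Consistency: if $Z\in R_g^{\mathtt A}[u]$ and $Z'\in R_g^{\mathtt B}[u]$, then $Z\cap Z'\ne\emptyset$. It is a *model of relational basic powers* if it also satisfies Union Closure: $\bigcup F\in R_g^P[u]$ for every non-empty $F\subseteq R_g^P[u]$. The relations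 are extended to all game terms by: - $R_{G+H}^{\mathtt A}[u]$ consists of all $Z\in R_G^{\mathtt A}[u]$, all $Z\in R_H^{\mathtt A}[u]$, and all $Z_1\cup Z_2$ with $Z_1\in R_G^{\mathtt A}[u]$, $Z_2\in R_H^{\mathtt A}[u]$; and $R_{G+H}^{\mathtt B}[u]$ consists of all $Z_1\cup Z_2$ with $Z_1\in R_G^{\mathtt B}[u]$, $Z_2\in R_H^{\mathtt B}[u]$; - $R_{G\times H}$ is defined in the same way with $\mathtt A$ and $\mathtt B$ exchanged; - $R_{-G}^P=R_G^{\overline P}$; - $(u,Z)\in R_{G\circ H}^P$ iff $Z=\bigcup F$ for some $F\subseteq\mathcal P(W)$ and some $Y$ with $(u,Y)\in R_G^P$ and $(Y,F)\in\widetilde{R_H^P}$ (Egli–Milner lifting: every $y\in Y$ is $R_H^P$-related to some member of $F$, and every member of $F$ is one to which some $y\in Y$ is $R_H^P$-related). Truth is as usual for the Boolean connectives; $[G,P](\Psi;\varphi)$ is true at $u$ iff there is $Z$ with $(u,Z)\in R_G^P$ such that $\varphi$ is true everywhere in $Z$ and each $\psi\in\Psi$ is true somewhere in $Z$. A formula is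 valid over a class of models if it is true at all worlds of all models in the class. **Axioms**, for all game terms $G,H$ and players $P$. *Base:* all propositional tautologies, and - (Mon) $[G,P](\psi_1,\dots,\psi_n;\varphi)\to[G,P](\psi_1\vee\alpha_1,\dots,\psi_n\vee\alpha_n;\varphi\vee\beta)$ - (Weak) $[G,P](\Psi;\varphi)\to[G,P](\Psi';\varphi)$ for $\Psi'\subseteq\Psi$ - (Un) $[G,P](\psi_1,\dots,\psi_n;\varphi)\to[G,P](\psi_1\wedge\varphi,\dots,\psi_n\wedge\varphi;\varphi)$ - (Lem) $[G,P](\Psi;\varphi)\to[G,P](\Psi\cup\{\gamma\};\varphi)\vee[G,P](\Psi;\varphi\wedge\neg\gamma)$ - (Bot) $\neg[G,P](\bot;\varphi)$ - (Non-Em) $[G,P]\top$ - (Inst) $[G,P](\psi;\top)\leftrightarrow[G,\overline P](\psi;\top)$ - (Cons) $[G,P]\varphi\to\neg[G,\overline P]\neg\varphi$. *Union:* $[G,P](\Psi;\varphi)\wedge[G,P](\Psi';\varphi)\to[G,P](\Psi\cup\Psi';\varphi)$. *Recursion:* write $S^P_{G,H}(\Psi;\varphi)$ for the disjunction of $[G,P](\Psi_1;\varphi)\wedge[H,P](\Psi_2;\varphi)$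 over all ways of splitting $\Psi$ into two parts $\Psi_1,\Psi_2$. - $[G+H,\mathtt A](\Psi;\varphi)\leftrightarrow[G,\mathtt A](\Psi;\varphi)\vee[H,\mathtt A](\Psi;\varphi)\vee S^{\mathtt A}_{G,H}(\Psi;\varphi)$ and $[G+H,\mathtt B](\Psi;\varphi)\leftrightarrow S^{\mathtt B}_{G,H}(\Psi;\varphi)$ - $[G\times H,\mathtt B](\Psi;\varphi)\leftrightarrow[G,\mathtt B](\Psi;\varphi)\vee[H,\mathtt B](\Psi;\varphi)\vee S^{\mathtt B}_{G,H}(\Psi;\varphi)$ and $[G\times H,\mathtt A](\Psi;\varphi)\leftrightarrow S^{\mathtt A}_{G,H}(\Psi;\varphi)$ - $[-G,P](\Psi;\varphi)\leftrightarrow[G,\overline P](\Psi;\varphi)$ - $[G\circ H,P](\psi_1,\dots,\psi_n;\varphi)\leftrightarrow[G,P]\big([H,P](\psi_1;\varphi),\dots,[H,P](\psi_n;\varphi);\,[H,P]\varphi\big)$. *Rules:* Modus Ponens, and Replacement of Equivalents (from $\varphi\leftrightarrow\psi$ and $\theta$ infer any result of replacing some occurrences of $\psi$ in $\theta$ by $\varphi$).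 **Theorem.** The dynamic game logic of relational basic powers is completely axiomatizable: a formula is valid over all models of relational basic powers if and only if it is derivable from the Base, Union and Recursion axioms. Moreover, a formula is valid over all instantial game models (without Union Closure) if and only if it is derivable from the Base and Recursion axioms alone. -/

import Mathlib

universe u v w

namespace DynamicGameLogic

/-- The two players, Alice and Bob. -/
inductive Player
  | alice
  | bob

/-- The opponent of a player. -/
def Player.other : Player → Player
  | .alice => .bob
  | .bob => .alice

/-- Game terms over a set `Gm` of atomic games. -/
inductive Game (Gm : Type v) : Type v
  /-- an atomic game -/
  | atom (g : Gm)
  /-- `G + H`: Alice chooses which of the two games is played -/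
  | add (G H : Game Gm)
  /-- `G × H`: Bob chooses which of the two games is played -/
  | mul (G H : Game Gm)
  /-- `− G`: the players switch roles -/
  | dual (G : Game Gm)
  /-- `G ∘ H`: first `G` is played, then `H` -/
  | comp (G H : Game Gm)

/-- Formulas. In `box G P Ψ φ`, written `[G, P](Ψ; φ)`, the finite set `Ψ` is given by a list
of its elements; order and repetitions are irrelevant, both for the truth of the formula and
(by the axiom `weak`) for provability. -/
inductive Formula (Prp : Type u) (Gm : Type v) : Type (max u v)
  | var (p : Prp)
  | bot
  | neg (φ : Formula Prp Gm)
  | and (φ ψ : Formula Prp Gm)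
  | box (G : Game Gm) (P : Player) (Ψ : List (Formula Prp Gm)) (φ : Formula Prp Gm)

section Abbreviations

variable {Prp : Type u} {Gm : Type v}

namespace Formula

/-- `⊤` -/
def top : Formula Prp Gm := neg bot

/-- `φ ∨ ψ` -/
def or (φ ψ : Formula Prp Gm) : Formula Prp Gm := neg (and (neg φ) (neg ψ))

/-- `φ → ψ` -/
def imp (φ ψ : Formula Prp Gm) : Formula Prp Gm := neg (and φ (neg ψ))

/-- `φ ↔ ψ` -/
def iff (φ ψ : Formula Prp Gm) : Formula Prp Gm := and (imp φ ψ) (imp ψ φ)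

/-- The disjunction of a finite list of formulas (`⊥` if the list is empty). -/
def disj (l : List (Formula Prp Gm)) : Formula Prp Gm := l.foldr or bot

end Formula

end Abbreviations

section Semantics

/-- The Egli–Milner lifting of a relation. -/
def EgliMilner {α : Type u} {β : Type v} (R : α → β → Prop) (S : Set α) (T : Set β) : Prop :=
  (∀ x ∈ S, ∃ y ∈ T, R x y) ∧ (∀ y ∈ T, ∃ x ∈ S, R x y)

/-- Instantial game models with set of worlds `W`: for every atomic game `g` and player `P`, a
relation between worlds `u` and sets `Z` of worlds, where `Z ∈ R g P u` says that `Z` is a basic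
power of `P` in the game `g` played at `u`; and a valuation. At every world, the basic powers of
the two players in an atomic game satisfy Non-emptiness, Instantiatedness and Consistency. -/
structure Model (Prp : Type u) (Gm : Type v) (W : Type w) where
  /-- the basic powers of a player in an atomic game at a world -/
  R : Gm → Player → W → Set (Set W)
  /-- the valuation -/
  V : Prp → Set W
  nonemptiness : ∀ g P u, (R g P u).Nonempty
  instantiatedness : ∀ g P u, ∀ Z ∈ R g P u, ∀ x ∈ Z, ∃ Z' ∈ R g P.other u, x ∈ Z'
  consistency : ∀ g u, ∀ Z ∈ R g .alice u, ∀ Z' ∈ R g .bob u, (Z ∩ Z').Nonempty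

variable {Prp : Type u} {Gm : Type v} {W : Type w}

/-- Union Closure: the condition on models that characterizes basic powers with respect to
relational (non-deterministic) strategies. -/
def Model.UnionClosed (M : Model Prp Gm W) : Prop :=
  ∀ g P u, ∀ F : Set (Set W), F ⊆ M.R g P u → F.Nonempty → ⋃₀ F ∈ M.R g P u

/-- Powers, in a choice between two games, of the player who makes the choice. The
relational strategy may allow the first game only, the second game only, or both. -/
def ownChoice (S T : Set (Set W)) : Set (Set W) :=
  {Z | Z ∈ S ∨ Z ∈ T ∨ ∃ Z₁ ∈ S, ∃ Z₂ ∈ T, Z = Z₁ ∪ Z₂}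

/-- Powers, in a choice between two games, of the player who does not make the choice. -/
def otherChoice (S T : Set (Set W)) : Set (Set W) :=
  {Z | ∃ Z₁ ∈ S, ∃ Z₂ ∈ T, Z = Z₁ ∪ Z₂}

/-- The relational basic powers of the players in the game denoted by a game term. -/
def Model.power (M : Model Prp Gm W) : Game Gm → Player → W → Set (Set W)
  | .atom g, P, u => M.R g P u
  | .add G H, .alice, u => ownChoice (M.power G .alice u) (M.power H .alice u)
  | .add G H, .bob, u => otherChoice (M.power G .bob u) (M.power H .bob u)
  | .mul G H, .alice, u => otherChoice (M.power G .alice u) (M.power H .alice u)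
  | .mul G H, .bob, u => ownChoice (M.power G .bob u) (M.power H .bob u)
  | .dual G, P, u => M.power G P.other u
  | .comp G H, P, u =>
      {Z | ∃ F : Set (Set W), Z = ⋃₀ F ∧
        ∃ Y ∈ M.power G P u, EgliMilner (fun y X => X ∈ M.power H P y) Y F}

/-- The truth set of a formula. -/
def Model.truth (M : Model Prp Gm W) : Formula Prp Gm → Set W
  | .var p => M.V p
  | .bot => ∅
  | .neg φ => (M.truth φ)ᶜ
  | .and φ ψ => M.truth φ ∩ M.truth ψ
  | .box G P Ψ φ =>
      {u | ∃ Z ∈ M.power G P u, Z ⊆ M.truth φ ∧ ∀ ψ ∈ Ψ, (Z ∩ M.truth ψ).Nonempty}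

/-- Validity over all instantial game models. -/
def Valid (φ : Formula Prp Gm) : Prop :=
  ∀ (W : Type w) (M : Model Prp Gm W) (x : W), x ∈ M.truth φ

/-- Validity over the instantial game models that satisfy Union Closure. -/
def RelValid (φ : Formula Prp Gm) : Prop :=
  ∀ (W : Type w) (M : Model Prp Gm W), M.UnionClosed → ∀ x : W, x ∈ M.truth φ

end Semantics

section ProofSystem

variable {Prp : Type u} {Gm : Type v}

open Formula

/-- Propositional tautologies, where variables and formulas `[G, P](Ψ; φ)` count as atoms. -/
def IsTautology (φ : Formula Prp Gm) : Prop :=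
  ∀ t : Formula Prp Gm → Prop, ¬ t bot → (∀ ψ, t (neg ψ) ↔ ¬ t ψ) →
    (∀ ψ χ, t (and ψ χ) ↔ t ψ ∧ t χ) → t φ

/-- The axioms of instantial game logic, for the modalities of every game term. -/
inductive BaseAxiom : Formula Prp Gm → Prop
  | taut (φ : Formula Prp Gm) : IsTautology φ → BaseAxiom φ
  /-- The list `l` is `(ψ₁, α₁), …, (ψₙ, αₙ)`. -/
  | mon (G : Game Gm) (P : Player) (l : List (Formula Prp Gm × Formula Prp Gm))
      (φ β : Formula Prp Gm) :
      BaseAxiom (imp (box G P (l.map fun x => x.1) φ)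
        (box G P (l.map fun x => or x.1 x.2) (or φ β)))
  | weak (G : Game Gm) (P : Player) (Ψ Ψ' : List (Formula Prp Gm)) (φ : Formula Prp Gm) :
      Ψ' ⊆ Ψ → BaseAxiom (imp (box G P Ψ φ) (box G P Ψ' φ))
  | un (G : Game Gm) (P : Player) (Ψ : List (Formula Prp Gm)) (φ : Formula Prp Gm) :
      BaseAxiom (imp (box G P Ψ φ) (box G P (Ψ.map fun ψ => and ψ φ) φ))
  | lem (G : Game Gm) (P : Player) (Ψ : List (Formula Prp Gm)) (φ γ : Formula Prp Gm) :
      BaseAxiom (imp (box G P Ψ φ) (or (box G P (Ψ ++ [γ]) φ) (box G P Ψ (and φ (neg γ)))))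
  | bot (G : Game Gm) (P : Player) (φ : Formula Prp Gm) :
      BaseAxiom (neg (box G P [Formula.bot] φ))
  | nonEm (G : Game Gm) (P : Player) : BaseAxiom (box G P [] top)
  | inst (G : Game Gm) (P : Player) (ψ : Formula Prp Gm) :
      BaseAxiom (iff (box G P [ψ] top) (box G P.other [ψ] top))
  | cons (G : Game Gm) (P : Player) (φ : Formula Prp Gm) :
      BaseAxiom (imp (box G P [] φ) (neg (box G P.other [] (neg φ))))

/-- The axiom for Union Closure. -/
inductive UnionAxiom : Formula Prp Gm → Prop
  | union (G : Game Gm) (P : Player) (Ψ Ψ' : List (Formula Prp Gm)) (φ : Formula Prp Gm) :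
      UnionAxiom (imp (and (box G P Ψ φ) (box G P Ψ' φ)) (box G P (Ψ ++ Ψ') φ))

/-- All ways of distributing the entries of a list over two lists. -/
def splits {α : Type w} : List α → List (List α × List α)
  | [] => [([], [])]
  | a :: l => (splits l).flatMap fun x => [(a :: x.1, x.2), (x.1, a :: x.2)]

/-- The disjunction of `[G, P](Ψ₁; φ) ∧ [H, P](Ψ₂; φ)` over all the ways of splitting `Ψ` into
two parts `Ψ₁` and `Ψ₂`. -/
def splitBox (G H : Game Gm) (P : Player) (Ψ : List (Formula Prp Gm)) (φ : Formula Prp Gm) :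
    Formula Prp Gm :=
  disj ((splits Ψ).map fun x => and (box G P x.1 φ) (box H P x.2 φ))

/-- The recursion axioms for the game operations. -/
inductive RecursionAxiom : Formula Prp Gm → Prop
  | add_alice (G H : Game Gm) (Ψ : List (Formula Prp Gm)) (φ : Formula Prp Gm) :
      RecursionAxiom (iff (box (.add G H) .alice Ψ φ)
        (or (or (box G .alice Ψ φ) (box H .alice Ψ φ)) (splitBox G H .alice Ψ φ)))
  | add_bob (G H : Game Gm) (Ψ : List (Formula Prp Gm)) (φ : Formula Prp Gm) :
      RecursionAxiom (iff (box (.add G H) .bob Ψ φ) (splitBox G H .bob Ψ φ))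
  | mul_alice (G H : Game Gm) (Ψ : List (Formula Prp Gm)) (φ : Formula Prp Gm) :
      RecursionAxiom (iff (box (.mul G H) .alice Ψ φ) (splitBox G H .alice Ψ φ))
  | mul_bob (G H : Game Gm) (Ψ : List (Formula Prp Gm)) (φ : Formula Prp Gm) :
      RecursionAxiom (iff (box (.mul G H) .bob Ψ φ)
        (or (or (box G .bob Ψ φ) (box H .bob Ψ φ)) (splitBox G H .bob Ψ φ)))
  | dual (G : Game Gm) (P : Player) (Ψ : List (Formula Prp Gm)) (φ : Formula Prp Gm) :
      RecursionAxiom (iff (box (.dual G) P Ψ φ) (box G P.other Ψ φ))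
  | comp (G H : Game Gm) (P : Player) (Ψ : List (Formula Prp Gm)) (φ : Formula Prp Gm) :
      RecursionAxiom (iff (box (.comp G H) P Ψ φ)
        (box G P (Ψ.map fun ψ => box H P [ψ] φ) (box H P [] φ)))

/-- `Replace φ ψ θ θ'`: the formula `θ'` results from `θ` by replacing some (possibly none, possibly
all) occurrences of the subformula `ψ` by `φ`. -/
inductive Replace (φ ψ : Formula Prp Gm) : Formula Prp Gm → Formula Prp Gm → Prop
  | here : Replace φ ψ ψ φ
  | refl (θ : Formula Prp Gm) : Replace φ ψ θ θ
  | neg {θ θ' : Formula Prp Gm} : Replace φ ψ θ θ' → Replace φ ψ (neg θ) (neg θ')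
  | and {θ θ' η η' : Formula Prp Gm} :
      Replace φ ψ θ θ' → Replace φ ψ η η' → Replace φ ψ (and θ η) (and θ' η')
  | box (G : Game Gm) (P : Player) {Ψ Ψ' : List (Formula Prp Gm)} {θ θ' : Formula Prp Gm} :
      Ψ.length = Ψ'.length →
      (∀ (i : ℕ) (h : i < Ψ.length) (h' : i < Ψ'.length), Replace φ ψ Ψ[i] Ψ'[i]) →
      Replace φ ψ θ θ' → Replace φ ψ (box G P Ψ θ) (box G P Ψ' θ')

/-- Provability from a set of axioms by Modus Ponens and Replacement of Equivalents. -/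
inductive Provable (Ax : Formula Prp Gm → Prop) : Formula Prp Gm → Prop
  | ax {φ : Formula Prp Gm} : Ax φ → Provable Ax φ
  | mp {φ ψ : Formula Prp Gm} : Provable Ax (imp φ ψ) → Provable Ax φ → Provable Ax ψ
  | re {φ ψ θ θ' : Formula Prp Gm} :
      Provable Ax (iff φ ψ) → Provable Ax θ → Replace φ ψ θ θ' → Provable Ax θ'

/-- Dynamic instantial game logic: the base axioms and the recursion axioms. -/
def DynAxiom (φ : Formula Prp Gm) : Prop := BaseAxiom φ ∨ RecursionAxiom φ

/-- The dynamic game logic of relational basic powers: the base axioms together with the axiom for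
Union Closure, and the recursion axioms. -/
def RelDynAxiom (φ : Formula Prp Gm) : Prop := DynAxiom φ ∨ UnionAxiom φ

end ProofSystem

end DynamicGameLogic

/-! Soundness. By induction on game terms, Non-emptiness, Instantiatedness and Consistency pass from
atomic games to all games, and so, under Union Closure, does closure under binary unions. (Non-Em),
(Inst), (Cons) and the Union axiom express these facts; the recursion axioms mirror the clauses for
composite games.

Completeness. Maximal consistent sets appear as Boolean assignments satisfying all theorems
(`IsModelOf`); by compactness, whatever holds under all of them is provable
(`Provable.of_forall_isModelOf`). The recursion axioms make every formula provably equivalent to one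
with atomic games only (`IsReducible.all`), which has finitely many variables and games and a
bounded modal depth.

For such a fragment a levelled canonical model is built from finitely many types per level. A type
of level `n + 1` decides the variables and the formulas `Ty.nabla`, each saying that some power
realizes exactly a given set `S` of types of level `n`; these sets `S` become the powers. The crux
is that (Lem), iterated over the finitely many types, refines any true modal formula to a true
`nabla` formula whose types witness it (`Ty.exists_nabla`). The remaining axioms turn into the
conditions on models, and the truth lemma is an induction in which each modality descends one level.
-/

namespace DynamicGameLogic

open Formula

/-! ### Boolean assignments -/

section Assignments

variable {Prp : Type u} {Gm : Type v}

/-- Assignments of truth values to formulas that respect the Boolean connectives. -/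
structure IsBoolean (t : Formula Prp Gm → Prop) : Prop where
  bot : ¬ t bot
  neg : ∀ ψ, t (neg ψ) ↔ ¬ t ψ
  and : ∀ ψ χ, t (and ψ χ) ↔ t ψ ∧ t χ

namespace IsBoolean

variable {t : Formula Prp Gm → Prop} (h : IsBoolean t)
include h

theorem top : t top := (h.neg _).2 h.bot

theorem or (ψ χ : Formula Prp Gm) : t (or ψ χ) ↔ t ψ ∨ t χ := by
  rw [Formula.or, h.neg, h.and, h.neg, h.neg]; tauto

theorem imp (ψ χ : Formula Prp Gm) : t (imp ψ χ) ↔ (t ψ → t χ) := by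
  rw [Formula.imp, h.neg, h.and, h.neg]; tauto

theorem iff (ψ χ : Formula Prp Gm) : t (iff ψ χ) ↔ (t ψ ↔ t χ) := by
  rw [Formula.iff, h.and, h.imp, h.imp]; tauto

theorem disj (l : List (Formula Prp Gm)) : t (disj l) ↔ ∃ ψ ∈ l, t ψ := by
  induction l with
  | nil => simpa [Formula.disj] using h.bot
  | cons a l ih =>
    have : Formula.disj (a :: l) = Formula.or a (Formula.disj l) := rfl
    rw [this, h.or, ih]; simp

theorem foldr_imp (l : List (Formula Prp Gm)) (φ : Formula Prp Gm) :
    t (l.foldr Formula.imp φ) ↔ ((∀ ψ ∈ l, t ψ) → t φ) := by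
  induction l with
  | nil => simp
  | cons a l ih => rw [List.foldr_cons, h.imp, ih]; simp

theorem foldr_and (l : List (Formula Prp Gm)) :
    t (l.foldr Formula.and Formula.top) ↔ ∀ ψ ∈ l, t ψ := by
  induction l with
  | nil => simpa using h.top
  | cons a l ih => rw [List.foldr_cons, h.and, ih]; simp

end IsBoolean

end Assignments

/-! ### Soundness -/

theorem Player.other_other (P : Player) : P.other.other = P := by cases P <;> rfl

/-! ### The conditions on powers under the two choice operations -/

section Choice

variable {W : Type w} {S T S' T' : Set (Set W)}

theorem ownChoice_nonempty (hS : S.Nonempty) : (ownChoice S T).Nonempty :=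
  hS.imp fun _ h => Or.inl h

theorem otherChoice_nonempty (hS : S.Nonempty) (hT : T.Nonempty) : (otherChoice S T).Nonempty :=
  let ⟨Z, hZ⟩ := hS
  let ⟨Z', hZ'⟩ := hT
  ⟨Z ∪ Z', Z, hZ, Z', hZ', rfl⟩

/-- The player who does not choose needs a power in both games: the set through `x` comes from one
of them and is padded with an arbitrary power in the other, which is where non-emptiness enters. -/
theorem exists_mem_otherChoice (hS : ∀ Z ∈ S, ∀ x ∈ Z, ∃ Z' ∈ S', x ∈ Z')
    (hT : ∀ Z ∈ T, ∀ x ∈ Z, ∃ Z' ∈ T', x ∈ Z') (hS' : S'.Nonempty) (hT' : T'.Nonempty)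
    {Z : Set W} (hZ : Z ∈ ownChoice S T) {x : W} (hx : x ∈ Z) :
    ∃ Z' ∈ otherChoice S' T', x ∈ Z' := by
  obtain ⟨A, hA⟩ := hS'
  obtain ⟨B, hB⟩ := hT'
  have left : ∀ Z ∈ S, x ∈ Z → ∃ Z' ∈ otherChoice S' T', x ∈ Z' := fun Z hZ hx =>
    let ⟨Z', hZ', hx'⟩ := hS Z hZ x hx
    ⟨Z' ∪ B, ⟨Z', hZ', B, hB, rfl⟩, Or.inl hx'⟩
  have right : ∀ Z ∈ T, x ∈ Z → ∃ Z' ∈ otherChoice S' T', x ∈ Z' := fun Z hZ hx =>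
    let ⟨Z', hZ', hx'⟩ := hT Z hZ x hx
    ⟨A ∪ Z', ⟨A, hA, Z', hZ', rfl⟩, Or.inr hx'⟩
  rcases hZ with hZ | hZ | ⟨Z₁, h₁, Z₂, h₂, rfl⟩
  · exact left Z hZ hx
  · exact right Z hZ hx
  · exact hx.elim (left _ h₁) (right _ h₂)

theorem exists_mem_ownChoice (hS : ∀ Z ∈ S, ∀ x ∈ Z, ∃ Z' ∈ S', x ∈ Z')
    (hT : ∀ Z ∈ T, ∀ x ∈ Z, ∃ Z' ∈ T', x ∈ Z')
    {Z : Set W} (hZ : Z ∈ otherChoice S T) {x : W} (hx : x ∈ Z) :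
    ∃ Z' ∈ ownChoice S' T', x ∈ Z' := by
  obtain ⟨Z₁, h₁, Z₂, h₂, rfl⟩ := hZ
  rcases hx with hx | hx
  · obtain ⟨Z', hZ', hx'⟩ := hS _ h₁ x hx
    exact ⟨Z', Or.inl hZ', hx'⟩
  · obtain ⟨Z', hZ', hx'⟩ := hT _ h₂ x hx
    exact ⟨Z', Or.inr (Or.inl hZ'), hx'⟩

/-- The chooser enters at least one of the two games and meets there the part that the opponent has
prepared for that game. -/
theorem choice_inter_nonempty (hS : ∀ Z ∈ S, ∀ Z' ∈ S', (Z ∩ Z').Nonempty)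
    (hT : ∀ Z ∈ T, ∀ Z' ∈ T', (Z ∩ Z').Nonempty)
    {Z Z' : Set W} (hZ : Z ∈ ownChoice S T) (hZ' : Z' ∈ otherChoice S' T') :
    (Z ∩ Z').Nonempty := by
  obtain ⟨A, hA, B, hB, rfl⟩ := hZ'
  rcases hZ with hZ | hZ | ⟨Z₁, h₁, Z₂, h₂, rfl⟩
  · exact (hS _ hZ _ hA).mono (by grind)
  · exact (hT _ hZ _ hB).mono (by grind)
  · exact (hS _ h₁ _ hA).mono (by grind)

/-- The third clause of `ownChoice` is what accommodates the union of a power in one game with a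
power in the other. -/
theorem ownChoice_union (hS : ∀ Z ∈ S, ∀ Z' ∈ S, Z ∪ Z' ∈ S)
    (hT : ∀ Z ∈ T, ∀ Z' ∈ T, Z ∪ Z' ∈ T) :
    ∀ Z ∈ ownChoice S T, ∀ Z' ∈ ownChoice S T, Z ∪ Z' ∈ ownChoice S T := by
  rintro Z (h | h | ⟨A, hA, B, hB, rfl⟩) Z' (h' | h' | ⟨A', hA', B', hB', rfl⟩)
  · exact Or.inl (hS _ h _ h')
  · exact Or.inr (Or.inr ⟨_, h, _, h', rfl⟩)
  · exact Or.inr (Or.inr ⟨_, hS _ h _ hA', _, hB', by grind⟩)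
  · exact Or.inr (Or.inr ⟨_, h', _, h, Set.union_comm _ _⟩)
  · exact Or.inr (Or.inl (hT _ h _ h'))
  · exact Or.inr (Or.inr ⟨_, hA', _, hT _ h _ hB', by grind⟩)
  · exact Or.inr (Or.inr ⟨_, hS _ hA _ h', _, hB, by grind⟩)
  · exact Or.inr (Or.inr ⟨_, hA, _, hT _ hB _ h', by grind⟩)
  · exact Or.inr (Or.inr ⟨_, hS _ hA _ hA', _, hT _ hB _ hB', by grind⟩)

theorem otherChoice_union (hS : ∀ Z ∈ S, ∀ Z' ∈ S, Z ∪ Z' ∈ S)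
    (hT : ∀ Z ∈ T, ∀ Z' ∈ T, Z ∪ Z' ∈ T) :
    ∀ Z ∈ otherChoice S T, ∀ Z' ∈ otherChoice S T, Z ∪ Z' ∈ otherChoice S T := by
  rintro _ ⟨A, hA, B, hB, rfl⟩ _ ⟨A', hA', B', hB', rfl⟩
  exact ⟨_, hS _ hA _ hA', _, hT _ hB _ hB', by grind⟩

end Choice

/-! ### Splittings of a list -/

theorem mem_splits_cover {α : Type w} {l : List α} {x : List α × List α} (hx : x ∈ splits l)
    {a : α} (ha : a ∈ l) : a ∈ x.1 ∨ a ∈ x.2 := by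
  induction l generalizing x with
  | nil => simp at ha
  | cons b l ih =>
    simp only [splits, List.mem_flatMap, List.mem_cons, List.not_mem_nil, or_false] at hx
    obtain ⟨y, hy, rfl | rfl⟩ := hx <;> rcases List.mem_cons.1 ha with rfl | ha <;>
      [skip; have := ih hy ha; skip; have := ih hy ha] <;> simp <;> tauto

theorem subset_of_mem_splits {α : Type w} {l : List α} {x : List α × List α}
    (hx : x ∈ splits l) : x.1 ⊆ l ∧ x.2 ⊆ l := by
  induction l generalizing x with
  | nil => simp_all [splits]
  | cons b l ih =>
    simp only [splits, List.mem_flatMap, List.mem_cons, List.not_mem_nil, or_false] at hx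
    obtain ⟨y, hy, rfl | rfl⟩ := hx
    · exact ⟨List.cons_subset_cons b (ih hy).1, List.subset_cons_of_subset b (ih hy).2⟩
    · exact ⟨List.subset_cons_of_subset b (ih hy).1, List.cons_subset_cons b (ih hy).2⟩

theorem exists_mem_splits {α : Type w} {p q : α → Prop} {l : List α} (h : ∀ a ∈ l, p a ∨ q a) :
    ∃ x ∈ splits l, (∀ a ∈ x.1, p a) ∧ ∀ a ∈ x.2, q a := by
  induction l with
  | nil => exact ⟨([], []), by simp [splits], by simp, by simp⟩
  | cons b l ih =>
    obtain ⟨x, hx, h₁, h₂⟩ := ih fun a ha => h a (List.mem_cons_of_mem _ ha)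
    rcases h b List.mem_cons_self with hb | hb
    · exact ⟨(b :: x.1, x.2), List.mem_flatMap.2 ⟨x, hx, by simp⟩, by simpa using ⟨hb, h₁⟩, h₂⟩
    · exact ⟨(x.1, b :: x.2), List.mem_flatMap.2 ⟨x, hx, by simp⟩, h₁, by simpa using ⟨hb, h₂⟩⟩

/-! ### Powers of composite games and truth of the axioms -/

namespace Model

variable {Prp : Type u} {Gm : Type v} {W : Type w} (M : Model Prp Gm W)

theorem power_nonempty (G : Game Gm) (P : Player) (u : W) : (M.power G P u).Nonempty := by
  induction G generalizing P u with
  | atom g => exact M.nonemptiness g P u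
  | add G H ihG ihH =>
    cases P
    · exact ownChoice_nonempty (ihG _ u)
    · exact otherChoice_nonempty (ihG _ u) (ihH _ u)
  | mul G H ihG ihH =>
    cases P
    · exact otherChoice_nonempty (ihG _ u) (ihH _ u)
    · exact ownChoice_nonempty (ihG _ u)
  | dual G ih => exact ih _ u
  | comp G H ihG ihH =>
    obtain ⟨Y, hY⟩ := ihG P u
    -- With `F` consisting of all powers of `H` at all points of `Y`, the second Egli–Milner
    -- condition holds by definition.
    refine ⟨_, {X | ∃ y ∈ Y, X ∈ M.power H P y}, rfl, Y, hY, fun y hy => ?_, fun X hX => hX⟩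
    obtain ⟨X, hX⟩ := ihH P y
    exact ⟨X, ⟨y, hy, hX⟩, hX⟩

theorem power_instantiated (G : Game Gm) (P : Player) (u : W) :
    ∀ Z ∈ M.power G P u, ∀ x ∈ Z, ∃ Z' ∈ M.power G P.other u, x ∈ Z' := by
  induction G generalizing P u with
  | atom g => exact M.instantiatedness g P u
  | add G H ihG ihH =>
    intro Z hZ x hx
    cases P
    · exact exists_mem_otherChoice (ihG _ u) (ihH _ u) (M.power_nonempty G _ u)
        (M.power_nonempty H _ u) hZ hx
    · exact exists_mem_ownChoice (ihG .bob u) (ihH .bob u) hZ hx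
  | mul G H ihG ihH =>
    intro Z hZ x hx
    cases P
    · exact exists_mem_ownChoice (ihG .alice u) (ihH .alice u) hZ hx
    · exact exists_mem_otherChoice (ihG _ u) (ihH _ u) (M.power_nonempty G _ u)
        (M.power_nonempty H _ u) hZ hx
  | dual G ih => exact ih _ u
  | comp G H ihG ihH =>
    rintro Z ⟨F, rfl, Y, hY, hYF, hFY⟩ x ⟨X, hXF, hx⟩
    obtain ⟨y, hy, hX⟩ := hFY X hXF
    obtain ⟨Y', hY', hy'⟩ := ihG P u Y hY y hy
    obtain ⟨X', hX', hx'⟩ := ihH P y X hX x hx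
    refine ⟨_, ⟨{X | ∃ y ∈ Y', X ∈ M.power H P.other y}, rfl, Y', hY', fun z hz => ?_,
      fun X hX => hX⟩, X', ⟨y, hy', hX'⟩, hx'⟩
    obtain ⟨X, hX⟩ := M.power_nonempty H P.other z
    exact ⟨X, ⟨z, hz, hX⟩, hX⟩

theorem power_consistent (G : Game Gm) (P : Player) (u : W) :
    ∀ Z ∈ M.power G P u, ∀ Z' ∈ M.power G P.other u, (Z ∩ Z').Nonempty := by
  induction G generalizing P u with
  | atom g =>
    cases P
    · exact M.consistency g u
    · exact fun Z hZ Z' hZ' => Set.inter_comm Z Z' ▸ M.consistency g u Z' hZ' Z hZ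
  | add G H ihG ihH =>
    cases P
    · exact fun Z hZ Z' hZ' => choice_inter_nonempty (ihG .alice u) (ihH .alice u) hZ hZ'
    · exact fun Z hZ Z' hZ' => Set.inter_comm Z Z' ▸
        choice_inter_nonempty (ihG .alice u) (ihH .alice u) hZ' hZ
  | mul G H ihG ihH =>
    cases P
    · exact fun Z hZ Z' hZ' => Set.inter_comm Z Z' ▸
        choice_inter_nonempty (ihG .bob u) (ihH .bob u) hZ' hZ
    · exact fun Z hZ Z' hZ' => choice_inter_nonempty (ihG .bob u) (ihH .bob u) hZ hZ'
  | dual G ih => exact ih _ u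
  | comp G H ihG ihH =>
    rintro _ ⟨F, rfl, Y, hY, hYF, -⟩ _ ⟨F', rfl, Y', hY', hYF', -⟩
    obtain ⟨y, hy, hy'⟩ := ihG P u Y hY Y' hY'
    obtain ⟨X, hXF, hX⟩ := hYF y hy
    obtain ⟨X', hXF', hX'⟩ := hYF' y hy'
    obtain ⟨x, hx, hx'⟩ := ihH P y X hX X' hX'
    exact ⟨x, ⟨X, hXF, hx⟩, X', hXF', hx'⟩

/-- Binary unions suffice for the Union axiom, so the arbitrary unions available at atomic games
need not be carried through the induction. For compositions, both the intermediate sets and the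
families are united. -/
theorem power_union {M : Model Prp Gm W} (hM : M.UnionClosed) (G : Game Gm) (P : Player) (u : W) :
    ∀ Z ∈ M.power G P u, ∀ Z' ∈ M.power G P u, Z ∪ Z' ∈ M.power G P u := by
  induction G generalizing P u with
  | atom g =>
    intro Z hZ Z' hZ'
    rw [← Set.sUnion_pair]
    exact hM g P u {Z, Z'} (Set.pair_subset hZ hZ') (Set.insert_nonempty _ _)
  | add G H ihG ihH =>
    cases P
    · exact ownChoice_union (ihG _ u) (ihH _ u)
    · exact otherChoice_union (ihG _ u) (ihH _ u)
  | mul G H ihG ihH =>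
    cases P
    · exact otherChoice_union (ihG _ u) (ihH _ u)
    · exact ownChoice_union (ihG _ u) (ihH _ u)
  | dual G ih => exact ih _ u
  | comp G H ihG ihH =>
    rintro _ ⟨F, rfl, Y, hY, hYF, hFY⟩ _ ⟨F', rfl, Y', hY', hYF', hFY'⟩
    refine ⟨F ∪ F', (Set.sUnion_union _ _).symm, Y ∪ Y', ihG P u Y hY Y' hY', ?_, ?_⟩
    · rintro y (hy | hy)
      · exact (hYF y hy).imp fun X hX => ⟨Or.inl hX.1, hX.2⟩
      · exact (hYF' y hy).imp fun X hX => ⟨Or.inr hX.1, hX.2⟩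
    · rintro X (hX | hX)
      · exact (hFY X hX).imp fun y hy => ⟨Or.inl hy.1, hy.2⟩
      · exact (hFY' X hX).imp fun y hy => ⟨Or.inr hy.1, hy.2⟩

theorem isBoolean_truth (x : W) : IsBoolean fun φ => x ∈ M.truth φ where
  bot := by simp [truth]
  neg ψ := by simp [truth]
  and ψ χ := by simp [truth]

theorem mem_truth_box {G : Game Gm} {P : Player} {Ψ : List (Formula Prp Gm)} {φ : Formula Prp Gm}
    {u : W} : u ∈ M.truth (box G P Ψ φ) ↔
      ∃ Z ∈ M.power G P u, Z ⊆ M.truth φ ∧ ∀ ψ ∈ Ψ, (Z ∩ M.truth ψ).Nonempty := by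
  simp only [truth, Set.mem_ofPred_eq]

/-- A union meets a set iff one of its two parts does, so a witnessing union determines a split of
`Ψ`, and the witnesses for a split combine to a union. -/
theorem mem_truth_splitBox {G H : Game Gm} {P : Player} {Ψ : List (Formula Prp Gm)}
    {φ : Formula Prp Gm} {u : W} : u ∈ M.truth (splitBox G H P Ψ φ) ↔
      ∃ Z ∈ otherChoice (M.power G P u) (M.power H P u),
        Z ⊆ M.truth φ ∧ ∀ ψ ∈ Ψ, (Z ∩ M.truth ψ).Nonempty := by
  have hb := M.isBoolean_truth u
  simp only [splitBox, hb.disj, List.mem_map, exists_exists_and_eq_and, hb.and, mem_truth_box]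
  constructor
  · rintro ⟨x, hx, ⟨Z, hZ, hφ, hΨ⟩, Z', hZ', hφ', hΨ'⟩
    refine ⟨Z ∪ Z', ⟨Z, hZ, Z', hZ', rfl⟩, Set.union_subset hφ hφ', fun ψ hψ => ?_⟩
    rcases mem_splits_cover hx hψ with h | h
    · exact (hΨ ψ h).mono (by grind)
    · exact (hΨ' ψ h).mono (by grind)
  · rintro ⟨_, ⟨Z, hZ, Z', hZ', rfl⟩, hφ, hΨ⟩
    simp only [Set.union_inter_distrib_right, Set.union_nonempty] at hΨ
    obtain ⟨x, hx, h₁, h₂⟩ := exists_mem_splits hΨ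
    exact ⟨x, hx, ⟨Z, hZ, fun a ha => hφ (Or.inl ha), h₁⟩, Z', hZ',
      fun a ha => hφ (Or.inr ha), h₂⟩

theorem truth_base {φ : Formula Prp Gm} (h : BaseAxiom φ) (x : W) : x ∈ M.truth φ := by
  have hb := M.isBoolean_truth
  cases h with
  | taut _ h => exact h (fun φ => x ∈ M.truth φ) (hb x).bot (hb x).neg (hb x).and
  | mon G P l φ β =>
    rw [(hb x).imp, mem_truth_box, mem_truth_box]
    rintro ⟨Z, hZ, hφ, hl⟩
    refine ⟨Z, hZ, fun y hy => ((hb y).or _ _).2 (Or.inl (hφ hy)), fun ψ hψ => ?_⟩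
    obtain ⟨a, ha, rfl⟩ := List.mem_map.1 hψ
    obtain ⟨y, hy, hya⟩ := hl a.1 (List.mem_map_of_mem ha)
    exact ⟨y, hy, ((hb y).or _ _).2 (Or.inl hya)⟩
  | weak G P Ψ Ψ' φ h =>
    rw [(hb x).imp, mem_truth_box, mem_truth_box]
    rintro ⟨Z, hZ, hφ, hl⟩
    exact ⟨Z, hZ, hφ, fun ψ hψ => hl ψ (h hψ)⟩
  | un G P Ψ φ =>
    rw [(hb x).imp, mem_truth_box, mem_truth_box]
    rintro ⟨Z, hZ, hφ, hl⟩
    refine ⟨Z, hZ, hφ, fun ψ hψ => ?_⟩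
    obtain ⟨a, ha, rfl⟩ := List.mem_map.1 hψ
    obtain ⟨y, hy, hya⟩ := hl a ha
    exact ⟨y, hy, ((hb y).and _ _).2 ⟨hya, hφ hy⟩⟩
  | lem G P Ψ φ γ =>
    rw [(hb x).imp, (hb x).or, mem_truth_box, mem_truth_box, mem_truth_box]
    rintro ⟨Z, hZ, hφ, hl⟩
    by_cases hγ : (Z ∩ M.truth γ).Nonempty
    · refine Or.inl ⟨Z, hZ, hφ, fun ψ hψ => ?_⟩
      rcases List.mem_append.1 hψ with h | h
      · exact hl ψ h
      · rw [List.mem_singleton.1 h]; exact hγ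
    · exact Or.inr ⟨Z, hZ, fun y hy => ((hb y).and _ _).2
        ⟨hφ hy, ((hb y).neg _).2 fun h => hγ ⟨y, hy, h⟩⟩, hl⟩
  | bot G P φ =>
    rw [(hb x).neg, mem_truth_box]
    rintro ⟨Z, -, -, hl⟩
    obtain ⟨y, -, hy⟩ := hl _ (List.mem_singleton_self _)
    exact (hb y).bot hy
  | nonEm G P =>
    obtain ⟨Z, hZ⟩ := M.power_nonempty G P x
    exact M.mem_truth_box.2 ⟨Z, hZ, fun y _ => (hb y).top, by simp⟩
  | inst G P ψ =>
    have key : ∀ P : Player, x ∈ M.truth (box G P [ψ] top) →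
        x ∈ M.truth (box G P.other [ψ] top) := by
      intro P
      rw [mem_truth_box, mem_truth_box]
      rintro ⟨Z, hZ, -, hl⟩
      obtain ⟨y, hy, hyψ⟩ := hl _ (List.mem_singleton_self _)
      obtain ⟨Z', hZ', hy'⟩ := M.power_instantiated G P x Z hZ y hy
      exact ⟨Z', hZ', fun y _ => (hb y).top, by simpa using ⟨y, hy', hyψ⟩⟩
    refine ((hb x).iff _ _).2 ⟨key P, fun h => ?_⟩
    simpa only [Player.other_other] using key P.other h
  | cons G P φ =>
    rw [(hb x).imp, (hb x).neg, mem_truth_box, mem_truth_box]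
    rintro ⟨Z, hZ, hφ, -⟩ ⟨Z', hZ', hφ', -⟩
    obtain ⟨y, hy, hy'⟩ := M.power_consistent G P x Z hZ Z' hZ'
    exact ((hb y).neg _).1 (hφ' hy') (hφ hy)

theorem truth_recursion {φ : Formula Prp Gm} (h : RecursionAxiom φ) (x : W) : x ∈ M.truth φ := by
  have hb := M.isBoolean_truth x
  have own : ∀ (S T : Set (Set W)) (p : Set W → Prop), (∃ Z ∈ ownChoice S T, p Z) ↔
      (((∃ Z ∈ S, p Z) ∨ (∃ Z ∈ T, p Z)) ∨ ∃ Z ∈ otherChoice S T, p Z) := by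
    intro S T p
    simp only [ownChoice, otherChoice, Set.mem_ofPred_eq, or_and_right, exists_or, or_assoc]
  cases h with
  | add_alice G H Ψ φ =>
    simp only [hb.iff, hb.or, mem_truth_splitBox, mem_truth_box]
    exact own _ _ _
  | add_bob G H Ψ φ =>
    simp only [hb.iff, mem_truth_splitBox, mem_truth_box]
    exact Iff.rfl
  | mul_alice G H Ψ φ =>
    simp only [hb.iff, mem_truth_splitBox, mem_truth_box]
    exact Iff.rfl
  | mul_bob G H Ψ φ =>
    simp only [hb.iff, hb.or, mem_truth_splitBox, mem_truth_box]
    exact own _ _ _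
  | dual G P Ψ φ =>
    simp only [hb.iff, mem_truth_box]
    exact Iff.rfl
  | comp G H P Ψ φ =>
    rw [hb.iff, mem_truth_box, mem_truth_box]
    constructor
    · rintro ⟨_, ⟨F, rfl, Y, hY, hYF, hFY⟩, hφ, hΨ⟩
      refine ⟨Y, hY, fun y hy => ?_, fun χ hχ => ?_⟩
      · obtain ⟨X, hXF, hX⟩ := hYF y hy
        exact M.mem_truth_box.2 ⟨X, hX, fun z hz => hφ ⟨X, hXF, hz⟩, by simp⟩
      · obtain ⟨ψ, hψ, rfl⟩ := List.mem_map.1 hχ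
        obtain ⟨z, ⟨X, hXF, hz⟩, hzψ⟩ := hΨ ψ hψ
        obtain ⟨y, hy, hX⟩ := hFY X hXF
        exact ⟨y, hy, M.mem_truth_box.2 ⟨X, hX, fun z hz => hφ ⟨X, hXF, hz⟩,
          by simpa using ⟨z, hz, hzψ⟩⟩⟩
    · rintro ⟨Y, hY, hφ, hΨ⟩
      -- The largest admissible family: it contains witnesses for all `ψ` at once, and the
      -- assumption on `Y` gives every `y` a member.
      refine ⟨_, ⟨{X | (∃ y ∈ Y, X ∈ M.power H P y) ∧ X ⊆ M.truth φ}, rfl, Y, hY,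
        fun y hy => ?_, fun X hX => hX.1⟩, Set.sUnion_subset fun X hX => hX.2, fun ψ hψ => ?_⟩
      · obtain ⟨X, hX, hXφ, -⟩ := M.mem_truth_box.1 (hφ hy)
        exact ⟨X, ⟨⟨y, hy, hX⟩, hXφ⟩, hX⟩
      · obtain ⟨y, hy, hyψ⟩ := hΨ _ (List.mem_map_of_mem hψ)
        obtain ⟨X, hX, hXφ, hXψ⟩ := M.mem_truth_box.1 hyψ
        obtain ⟨z, hz, hzψ⟩ := hXψ ψ (List.mem_singleton_self _)
        exact ⟨z, ⟨X, ⟨⟨y, hy, hX⟩, hXφ⟩, hz⟩, hzψ⟩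

theorem truth_union {M : Model Prp Gm W} (hM : M.UnionClosed) {φ : Formula Prp Gm}
    (h : UnionAxiom φ) (x : W) : x ∈ M.truth φ := by
  have hb := M.isBoolean_truth x
  cases h with
  | union G P Ψ Ψ' φ =>
    rw [hb.imp, hb.and, mem_truth_box, mem_truth_box, mem_truth_box]
    rintro ⟨⟨Z, hZ, hφ, hΨ⟩, Z', hZ', hφ', hΨ'⟩
    refine ⟨Z ∪ Z', power_union hM G P x Z hZ Z' hZ', Set.union_subset hφ hφ', fun ψ hψ => ?_⟩
    rcases List.mem_append.1 hψ with h | h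
    · exact (hΨ ψ h).mono (by grind)
    · exact (hΨ' ψ h).mono (by grind)

theorem truth_replace {φ ψ θ θ' : Formula Prp Gm} (h : M.truth φ = M.truth ψ)
    (hr : Replace φ ψ θ θ') : M.truth θ = M.truth θ' := by
  induction hr with
  | here => exact h.symm
  | refl => rfl
  | neg _ ih => simp only [truth, ih]
  | and _ _ ih₁ ih₂ => simp only [truth, ih₁, ih₂]
  | @box G P Ψ Ψ' θ θ' hlen _ _ ihΨ ih =>
    ext u
    rw [mem_truth_box, mem_truth_box, ih]
    simp only [List.forall_mem_iff_forall_getElem]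
    refine exists_congr fun Z => and_congr_right fun _ => and_congr_right fun _ =>
      ⟨fun h i hi => ?_, fun h i hi => ?_⟩
    · rw [← ihΨ i (hlen ▸ hi) hi]; exact h i _
    · rw [ihΨ i hi (hlen ▸ hi)]; exact h i _

theorem truth_provable {Ax : Formula Prp Gm → Prop} (hAx : ∀ φ, Ax φ → ∀ x, x ∈ M.truth φ)
    {φ : Formula Prp Gm} (h : Provable Ax φ) : ∀ x, x ∈ M.truth φ := by
  induction h with
  | ax h => exact hAx _ h
  | mp _ _ ih₁ ih₂ => exact fun x => ((M.isBoolean_truth x).imp _ _).1 (ih₁ x) (ih₂ x)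
  | re _ _ hr ih₁ ih₂ =>
    have := M.truth_replace (Set.ext fun x => ((M.isBoolean_truth x).iff _ _).1 (ih₁ x)) hr
    exact fun x => this ▸ ih₂ x

theorem truth_dynAxiom {φ : Formula Prp Gm} (h : DynAxiom φ) (x : W) : x ∈ M.truth φ :=
  h.elim (fun h => M.truth_base h x) (fun h => M.truth_recursion h x)

end Model

theorem Provable.valid {Prp : Type u} {Gm : Type v} {φ : Formula Prp Gm}
    (h : Provable DynAxiom φ) : Valid.{u, v, w} φ :=
  fun _ M => M.truth_provable (fun _ => M.truth_dynAxiom) h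

theorem Provable.relValid {Prp : Type u} {Gm : Type v} {φ : Formula Prp Gm}
    (h : Provable RelDynAxiom φ) : RelValid.{u, v, w} φ :=
  fun _ M hM => M.truth_provable
    (fun _ h x => h.elim (fun h => M.truth_dynAxiom h x) (fun h => M.truth_union hM h x)) h

/-! ### Provability and assignments -/

section Provability

variable {Prp : Type u} {Gm : Type v} {Ax : Formula Prp Gm → Prop}

/-- Boolean assignments under which all theorems are true. -/
structure IsModelOf (Ax : Formula Prp Gm → Prop) (t : Formula Prp Gm → Prop) : Prop extends
    IsBoolean t where
  provable : ∀ φ, Provable Ax φ → t φ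

theorem Provable.of_tautology (hAx : ∀ φ, BaseAxiom φ → Ax φ) {φ : Formula Prp Gm}
    (h : ∀ t : Formula Prp Gm → Prop, IsBoolean t → t φ) : Provable Ax φ :=
  .ax (hAx _ (.taut _ fun t h₁ h₂ h₃ => h t ⟨h₁, h₂, h₃⟩))

theorem Provable.of_foldr_imp {l : List (Formula Prp Gm)} (hl : ∀ ψ ∈ l, Provable Ax ψ)
    {φ : Formula Prp Gm} (h : Provable Ax (l.foldr imp φ)) : Provable Ax φ := by
  induction l with
  | nil => exact h
  | cons a l ih =>
    exact ih (fun ψ hψ => hl ψ (List.mem_cons_of_mem _ hψ)) (.mp h (hl a List.mem_cons_self))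

theorem isClosed_setOf_isBoolean :
    IsClosed {t : Formula Prp Gm → Bool | IsBoolean fun φ => t φ = true} := by
  have hc : ∀ φ : Formula Prp Gm, Continuous fun t : Formula Prp Gm → Bool => t φ :=
    continuous_apply
  have : {t : Formula Prp Gm → Bool | IsBoolean fun φ => t φ = true} =
      {t | t bot = false} ∩ ((⋂ ψ, {t | t (neg ψ) = !(t ψ)}) ∩
        ⋂ ψ, ⋂ χ, {t | t (and ψ χ) = (t ψ && t χ)}) := by
    ext t
    simp only [Set.mem_inter_iff, Set.mem_iInter, Set.mem_ofPred_eq]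
    constructor
    · intro h
      exact ⟨by simpa using h.bot, fun ψ => by have := h.neg ψ; grind,
        fun ψ χ => by have := h.and ψ χ; grind⟩
    · rintro ⟨h₁, h₂, h₃⟩
      exact ⟨by simp [h₁], fun ψ => by simp [h₂], fun ψ χ => by simp [h₃]⟩
  rw [this]
  refine (isClosed_eq (hc _) continuous_const).inter
    ((isClosed_iInter fun ψ => isClosed_eq (hc _) ?_).inter
      (isClosed_iInter fun ψ => isClosed_iInter fun χ => isClosed_eq (hc _) ?_))
  · exact (continuous_of_discreteTopology (f := Bool.not)).comp (hc ψ)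
  · exact (continuous_of_discreteTopology (f := fun p : Bool × Bool => p.1 && p.2)).comp
      ((hc ψ).prodMk (hc χ))

/-- Lindenbaum's lemma via Tychonoff: the Boolean assignments refuting `φ` form a compact set. If
none of them satisfies all theorems, finitely many theorems already exclude them all, and these
imply `φ` tautologically. -/
theorem Provable.of_forall_isModelOf (hAx : ∀ φ, BaseAxiom φ → Ax φ) {φ : Formula Prp Gm}
    (h : ∀ t, IsModelOf Ax t → t φ) : Provable Ax φ := by
  classical
  have hc : ∀ φ : Formula Prp Gm, Continuous fun t : Formula Prp Gm → Bool => t φ :=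
    continuous_apply
  have hK : IsCompact ({t : Formula Prp Gm → Bool | IsBoolean fun φ => t φ = true} ∩
      {t | t φ = false}) :=
    (isClosed_setOf_isBoolean.inter (isClosed_eq (hc φ) continuous_const)).isCompact
  obtain ⟨l, hl⟩ := hK.elim_finite_subfamily_closed
    (fun ψ : {ψ // Provable Ax ψ} => {t : Formula Prp Gm → Bool | t ψ = true})
    (fun ψ => isClosed_eq (hc ψ) continuous_const) (by
      refine Set.eq_empty_of_forall_notMem ?_
      rintro t ⟨⟨hb, hφ⟩, ht⟩
      simp only [Set.mem_iInter, Set.mem_ofPred_eq] at ht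
      have := h _ ⟨hb, fun ψ hψ => ht ⟨ψ, hψ⟩⟩
      rw [Set.mem_ofPred_eq] at hφ
      simp [hφ] at this)
  refine Provable.of_foldr_imp (l := l.toList.map (·.1)) ?_ (Provable.of_tautology hAx ?_)
  · intro ψ hψ
    obtain ⟨χ, -, rfl⟩ := List.mem_map.1 hψ
    exact χ.2
  · intro t ht
    refine (ht.foldr_imp _ _).2 fun hψ => ?_
    by_contra hφ
    have : (fun χ => decide (t χ)) ∈ (∅ : Set (Formula Prp Gm → Bool)) := by
      rw [← hl]
      refine ⟨⟨?_, by simpa using hφ⟩, ?_⟩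
      · simpa using ht
      · simp only [Set.mem_iInter, Set.mem_ofPred_eq, decide_eq_true_eq]
        intro χ hχ
        exact hψ χ (List.mem_map_of_mem (Finset.mem_toList.2 hχ))
    exact this

theorem provable_iff_iff (hAx : ∀ φ, BaseAxiom φ → Ax φ) {φ ψ : Formula Prp Gm} :
    Provable Ax (iff φ ψ) ↔ ∀ t, IsModelOf Ax t → (t φ ↔ t ψ) :=
  ⟨fun h _ ht => (ht.iff _ _).1 (ht.provable _ h),
    fun h => .of_forall_isModelOf hAx fun _ ht => (ht.iff _ _).2 (h _ ht)⟩

theorem Replace.of_append (φ ψ : Formula Prp Gm) (G : Game Gm) (P : Player)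
    (l l' : List (Formula Prp Gm)) (θ : Formula Prp Gm) :
    Replace φ ψ (.box G P (l ++ ψ :: l') θ) (.box G P (l ++ φ :: l') θ) := by
  refine .box G P (by simp) (fun i h h' => ?_) (.refl θ)
  rcases lt_trichotomy i l.length with hi | rfl | hi
  · rw [List.getElem_append_left hi, List.getElem_append_left hi]
    exact .refl _
  · simpa using Replace.here
  · obtain ⟨j, rfl⟩ := Nat.exists_eq_add_of_lt hi
    have e : ∀ (a : Formula Prp Gm) (h : l.length + j + 1 < (l ++ a :: l').length),
        (l ++ a :: l')[l.length + j + 1] = l'[j]'(by simp at h; omega) := by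
      intro a h
      rw [List.getElem_append_right (by omega)]
      simp [show l.length + j + 1 - l.length = j + 1 by omega]
    rw [e, e]
    exact .refl _

/-- Provably equivalent formulas may be replaced inside a context. -/
theorem Provable.iff_of_replace (hAx : ∀ φ, BaseAxiom φ → Ax φ) {φ ψ θ θ' : Formula Prp Gm}
    (h : Provable Ax (iff φ ψ)) (hr : Replace φ ψ θ θ') : Provable Ax (iff θ θ') := by
  have h0 : Provable Ax (iff θ θ) := .of_tautology hAx fun _ ht => (ht.iff _ _).2 Iff.rfl
  -- In the tautology `θ ↔ θ`, the replacement is made in the consequent of one implication and the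
  -- antecedent of the other.
  exact .re h h0 (.and (.neg (.and (.refl _) (.neg hr))) (.neg (.and hr (.neg (.refl _)))))

theorem provable_box_congr (hAx : ∀ φ, BaseAxiom φ → Ax φ) (G : Game Gm) (P : Player)
    {φ φ' : Formula Prp Gm} (hφ : Provable Ax (iff φ φ')) {α : Type*} (f g : α → Formula Prp Gm)
    {l : List α} (h : ∀ a ∈ l, Provable Ax (iff (f a) (g a))) :
    Provable Ax (iff (box G P (l.map f) φ) (box G P (l.map g) φ')) := by
  have symm : ∀ {φ ψ : Formula Prp Gm}, Provable Ax (iff φ ψ) → Provable Ax (iff ψ φ) := by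
    intro φ ψ h
    rw [provable_iff_iff hAx] at h ⊢
    exact fun t ht => (h t ht).symm
  have trans : ∀ {φ ψ χ : Formula Prp Gm}, Provable Ax (iff φ ψ) → Provable Ax (iff ψ χ) →
      Provable Ax (iff φ χ) := by
    intro φ ψ χ h h'
    rw [provable_iff_iff hAx] at h h' ⊢
    exact fun t ht => (h t ht).trans (h' t ht)
  -- Entries are exchanged one at a time, since each use of the rule concerns a single pair of
  -- formulas; `l₀` holds the entries already exchanged.
  have key : ∀ l₀ : List (Formula Prp Gm),
      Provable Ax (iff (box G P (l₀ ++ l.map f) φ) (box G P (l₀ ++ l.map g) φ)) := by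
    induction l with
    | nil => exact fun l₀ => .of_tautology hAx fun _ ht => (ht.iff _ _).2 Iff.rfl
    | cons a l ih =>
      intro l₀
      have h₁ := Provable.iff_of_replace hAx (symm (h a List.mem_cons_self))
        (Replace.of_append (g a) (f a) G P l₀ (l.map f) φ)
      have h₂ := ih (fun b hb => h b (List.mem_cons_of_mem _ hb)) (l₀ ++ [g a])
      simp only [List.append_assoc, List.singleton_append] at h₂
      exact trans h₁ h₂
  refine trans (key []) (Provable.iff_of_replace hAx (symm hφ) ?_)
  exact .box G P rfl (fun i _ _ => .refl _) .here

/-! ### Derived rules for the modalities -/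

namespace IsModelOf

variable {t : Formula Prp Gm → Prop} {G : Game Gm} {P : Player}
  {Ψ Ψ' : List (Formula Prp Gm)} {φ φ' : Formula Prp Gm}

theorem base (ht : IsModelOf Ax t) (hAx : ∀ φ, BaseAxiom φ → Ax φ) (h : BaseAxiom φ) : t φ :=
  ht.provable _ (.ax (hAx _ h))

theorem box_weak (ht : IsModelOf Ax t) (hAx : ∀ φ, BaseAxiom φ → Ax φ) (h : t (box G P Ψ φ))
    (hs : Ψ' ⊆ Ψ) : t (box G P Ψ' φ) :=
  (ht.imp _ _).1 (ht.base hAx (.weak G P Ψ Ψ' φ hs)) h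

/-- (Weak) first restricts to suitable stronger formulas from `Ψ`. (Mon) then adds each target as a
disjunct; a disjunction of a formula with a consequence of it is equivalent to the consequence,
which Replacement puts in its place. -/
theorem box_mono (ht : IsModelOf Ax t) (hAx : ∀ φ, BaseAxiom φ → Ax φ) (h : t (box G P Ψ φ))
    (hΨ : ∀ ψ' ∈ Ψ', ∃ ψ ∈ Ψ, ∀ s, IsModelOf Ax s → s ψ → s ψ')
    (hφ : ∀ s, IsModelOf Ax s → s φ → s φ') : t (box G P Ψ' φ') := by
  classical
  have : ∀ ψ', ∃ ψ, ψ' ∈ Ψ' → ψ ∈ Ψ ∧ ∀ s, IsModelOf Ax s → s ψ → s ψ' := by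
    intro ψ'
    by_cases h : ψ' ∈ Ψ'
    · exact (hΨ ψ' h).imp fun ψ hψ _ => hψ
    · exact ⟨ψ', fun h' => absurd h' h⟩
  choose f hf using this
  have h₁ : t (box G P (Ψ'.map f) φ) := by
    refine ht.box_weak hAx h fun ψ hψ => ?_
    obtain ⟨ψ', hψ', rfl⟩ := List.mem_map.1 hψ
    exact (hf ψ' hψ').1
  have h₂ := (ht.imp _ _).1 (ht.base hAx (.mon G P (Ψ'.map fun ψ => (f ψ, ψ)) φ φ'))
    (by simpa [Function.comp_def] using h₁)
  rw [List.map_map] at h₂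
  have h₃ := provable_box_congr hAx G P (φ := or φ φ') (φ' := φ')
    ((provable_iff_iff hAx).2 fun s hs => by rw [hs.or]; have := hφ s hs; tauto)
    ((fun x : Formula Prp Gm × Formula Prp Gm => or x.1 x.2) ∘ fun ψ => (f ψ, ψ)) id (l := Ψ')
    (fun ψ hψ => (provable_iff_iff hAx).2 fun s hs => by
      have := (hf ψ hψ).2 s hs
      simp only [Function.comp_apply, id_eq, hs.or]
      tauto)
  rw [List.map_id] at h₃
  exact ((ht.iff _ _).1 (ht.provable _ h₃)).1 h₂

/-- By (Un) the witness for `ψ` also satisfies `φ`; were the two jointly inconsistent, (Bot) would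
be violated. -/
theorem box_consistent (ht : IsModelOf Ax t) (hAx : ∀ φ, BaseAxiom φ → Ax φ)
    (h : t (box G P Ψ φ)) {ψ : Formula Prp Gm} (hψ : ψ ∈ Ψ) :
    ∃ s, IsModelOf Ax s ∧ s ψ ∧ s φ := by
  by_contra! hn
  have h₁ := (ht.imp _ _).1 (ht.base hAx (.un G P Ψ φ)) h
  refine (ht.neg _).1 (ht.base hAx (.bot G P φ)) (ht.box_mono hAx h₁ ?_ fun _ _ => id)
  intro χ hχ
  rw [List.mem_singleton.1 hχ]
  refine ⟨_, List.mem_map_of_mem hψ, fun s hs h => ?_⟩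
  rw [hs.and] at h
  exact absurd h.2 (hn s hs h.1)

end IsModelOf

end Provability

/-! ### Reduction to atomic games -/

section Reduction

variable {Prp : Type u} {Gm : Type v} {Ax : Formula Prp Gm → Prop}

/-- `InFragment ps gs n φ`: the modalities in `φ` are those of the atomic games in `gs`, the
variables of `φ` are in `ps`, and the modal depth of `φ` is at most `n`. -/
inductive InFragment (ps : Set Prp) (gs : Set Gm) : ℕ → Formula Prp Gm → Prop
  | var {n : ℕ} {p : Prp} : p ∈ ps → InFragment ps gs n (var p)
  | bot {n : ℕ} : InFragment ps gs n bot
  | neg {n : ℕ} {φ : Formula Prp Gm} : InFragment ps gs n φ → InFragment ps gs n (neg φ)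
  | and {n : ℕ} {φ ψ : Formula Prp Gm} :
      InFragment ps gs n φ → InFragment ps gs n ψ → InFragment ps gs n (and φ ψ)
  | box {n : ℕ} {g : Gm} (P : Player) {Ψ : List (Formula Prp Gm)} {φ : Formula Prp Gm} :
      g ∈ gs → (∀ ψ ∈ Ψ, InFragment ps gs n ψ) → InFragment ps gs n φ →
      InFragment ps gs (n + 1) (box (.atom g) P Ψ φ)

theorem InFragment.mono {ps ps' : Set Prp} {gs gs' : Set Gm} (hp : ps ⊆ ps') (hg : gs ⊆ gs')
    {n n' : ℕ} (hn : n ≤ n') {φ : Formula Prp Gm} (h : InFragment ps gs n φ) :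
    InFragment ps' gs' n' φ := by
  induction h generalizing n' with
  | var h => exact .var (hp h)
  | bot => exact .bot
  | neg _ ih => exact .neg (ih hn)
  | and _ _ ih₁ ih₂ => exact .and (ih₁ hn) (ih₂ hn)
  | box P h _ _ ihΨ ih =>
    obtain ⟨m, rfl⟩ : ∃ m, n' = m + 1 := ⟨n' - 1, by omega⟩
    exact .box P (hg h) (fun ψ hψ => ihΨ ψ hψ (by omega)) (ih (by omega))

/-- Formulas that only contain modalities of atomic games. -/
def IsAtomic (φ : Formula Prp Gm) : Prop :=
  ∃ (ps : Set Prp) (gs : Set Gm) (n : ℕ), ps.Finite ∧ gs.Finite ∧ InFragment ps gs n φ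

theorem exists_fragment {l : List (Formula Prp Gm)} (h : ∀ φ ∈ l, IsAtomic φ) :
    ∃ (ps : Set Prp) (gs : Set Gm) (n : ℕ), ps.Finite ∧ gs.Finite ∧
      ∀ φ ∈ l, InFragment ps gs n φ := by
  induction l with
  | nil => exact ⟨∅, ∅, 0, Set.finite_empty, Set.finite_empty, by simp⟩
  | cons a l ih =>
    obtain ⟨ps, gs, n, hp, hg, hl⟩ := ih fun φ hφ => h φ (List.mem_cons_of_mem _ hφ)
    obtain ⟨ps', gs', n', hp', hg', ha⟩ := h a List.mem_cons_self
    refine ⟨ps ∪ ps', gs ∪ gs', max n n', hp.union hp', hg.union hg', fun φ hφ => ?_⟩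
    rcases List.mem_cons.1 hφ with rfl | hφ
    · exact ha.mono Set.subset_union_right Set.subset_union_right (le_max_right _ _)
    · exact (hl φ hφ).mono Set.subset_union_left Set.subset_union_left (le_max_left _ _)

theorem IsAtomic.neg {φ : Formula Prp Gm} : IsAtomic φ → IsAtomic (neg φ) :=
  fun ⟨ps, gs, n, hp, hg, h⟩ => ⟨ps, gs, n, hp, hg, .neg h⟩

theorem IsAtomic.and {φ ψ : Formula Prp Gm} (hφ : IsAtomic φ) (hψ : IsAtomic ψ) :
    IsAtomic (and φ ψ) := by
  obtain ⟨ps, gs, n, hp, hg, h⟩ := exists_fragment (l := [φ, ψ]) (by simp [hφ, hψ])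
  exact ⟨ps, gs, n, hp, hg, .and (h φ (by simp)) (h ψ (by simp))⟩

theorem IsAtomic.box (g : Gm) (P : Player) {Ψ : List (Formula Prp Gm)} {φ : Formula Prp Gm}
    (hΨ : ∀ ψ ∈ Ψ, IsAtomic ψ) (hφ : IsAtomic φ) : IsAtomic (box (.atom g) P Ψ φ) := by
  obtain ⟨ps, gs, n, hp, hg, h⟩ := exists_fragment (l := φ :: Ψ) (by simpa using ⟨hφ, hΨ⟩)
  have hgs : gs ⊆ insert g gs := Set.subset_insert _ _
  exact ⟨ps, insert g gs, n + 1, hp, hg.insert g, .box P (Set.mem_insert _ _)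
    (fun ψ hψ => (h ψ (by simp [hψ])).mono subset_rfl hgs le_rfl)
    ((h φ (by simp)).mono subset_rfl hgs le_rfl)⟩

/-- Formulas that are provably equivalent to one that only contains modalities of atomic games. -/
def IsReducible (Ax : Formula Prp Gm → Prop) (φ : Formula Prp Gm) : Prop :=
  ∃ φ', IsAtomic φ' ∧ Provable Ax (iff φ φ')

namespace IsReducible

variable (hAx : ∀ φ, BaseAxiom φ → Ax φ)
include hAx

theorem of_isAtomic {φ : Formula Prp Gm} (h : IsAtomic φ) : IsReducible Ax φ :=
  ⟨φ, h, (provable_iff_iff hAx).2 fun _ _ => Iff.rfl⟩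

theorem of_iff {φ ψ : Formula Prp Gm} (h : Provable Ax (iff φ ψ)) (hψ : IsReducible Ax ψ) :
    IsReducible Ax φ := by
  obtain ⟨χ, hχ, h'⟩ := hψ
  rw [provable_iff_iff hAx] at h h'
  exact ⟨χ, hχ, (provable_iff_iff hAx).2 fun t ht => (h t ht).trans (h' t ht)⟩

theorem neg {φ : Formula Prp Gm} (hφ : IsReducible Ax φ) : IsReducible Ax (neg φ) := by
  obtain ⟨φ', h, h'⟩ := hφ
  rw [provable_iff_iff hAx] at h'
  exact ⟨_, h.neg, (provable_iff_iff hAx).2 fun t ht => by rw [ht.neg, ht.neg, h' t ht]⟩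

theorem and {φ ψ : Formula Prp Gm} (hφ : IsReducible Ax φ) (hψ : IsReducible Ax ψ) :
    IsReducible Ax (and φ ψ) := by
  obtain ⟨φ', h₁, h₁'⟩ := hφ
  obtain ⟨ψ', h₂, h₂'⟩ := hψ
  rw [provable_iff_iff hAx] at h₁' h₂'
  exact ⟨_, h₁.and h₂,
    (provable_iff_iff hAx).2 fun t ht => by rw [ht.and, ht.and, h₁' t ht, h₂' t ht]⟩

theorem or {φ ψ : Formula Prp Gm} (hφ : IsReducible Ax φ) (hψ : IsReducible Ax ψ) :
    IsReducible Ax (or φ ψ) :=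
  neg hAx (and hAx (neg hAx hφ) (neg hAx hψ))

theorem disj {l : List (Formula Prp Gm)} (h : ∀ φ ∈ l, IsReducible Ax φ) :
    IsReducible Ax (disj l) := by
  induction l with
  | nil => exact of_isAtomic hAx ⟨∅, ∅, 0, Set.finite_empty, Set.finite_empty, .bot⟩
  | cons a l ih =>
    exact or hAx (h a List.mem_cons_self) (ih fun φ hφ => h φ (List.mem_cons_of_mem _ hφ))

theorem box_atom (g : Gm) (P : Player) {Ψ : List (Formula Prp Gm)} {φ : Formula Prp Gm}
    (hΨ : ∀ ψ ∈ Ψ, IsReducible Ax ψ) (hφ : IsReducible Ax φ) :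
    IsReducible Ax (box (.atom g) P Ψ φ) := by
  have : ∀ ψ, ∃ ψ', ψ ∈ Ψ → IsAtomic ψ' ∧ Provable Ax (iff ψ ψ') := by
    intro ψ
    by_cases h : ψ ∈ Ψ
    · exact (hΨ ψ h).imp fun _ h _ => h
    · exact ⟨ψ, fun h' => absurd h' h⟩
  choose f hf using this
  obtain ⟨φ', hφ', h'⟩ := hφ
  have h := provable_box_congr hAx (.atom g) P h' id f (l := Ψ) fun ψ hψ => (hf ψ hψ).2
  rw [List.map_id] at h
  refine ⟨_, IsAtomic.box g P (fun ψ hψ => ?_) hφ', h⟩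
  obtain ⟨χ, hχ, rfl⟩ := List.mem_map.1 hψ
  exact (hf χ hχ).1

theorem splitBox {G H : Game Gm} {P : Player} {Ψ : List (Formula Prp Gm)} {φ : Formula Prp Gm}
    (hG : ∀ Ψ' ⊆ Ψ, IsReducible Ax (box G P Ψ' φ))
    (hH : ∀ Ψ' ⊆ Ψ, IsReducible Ax (box H P Ψ' φ)) : IsReducible Ax (splitBox G H P Ψ φ) := by
  refine disj hAx fun χ hχ => ?_
  obtain ⟨x, hx, rfl⟩ := List.mem_map.1 hχ
  exact and hAx (hG _ (subset_of_mem_splits hx).1) (hH _ (subset_of_mem_splits hx).2)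

variable (hRec : ∀ φ, RecursionAxiom φ → Ax φ)
include hRec

theorem of_recursionAxiom {φ ψ : Formula Prp Gm} (h : RecursionAxiom (iff φ ψ))
    (hψ : IsReducible Ax ψ) : IsReducible Ax φ :=
  of_iff hAx (.ax (hRec _ h)) hψ

/-- Induction on the game with arbitrary reducible arguments: for a composition, the modalities of
`H` are reduced first and then serve as arguments of those of `G`. -/
theorem box (G : Game Gm) (P : Player) {Ψ : List (Formula Prp Gm)} {φ : Formula Prp Gm}
    (hΨ : ∀ ψ ∈ Ψ, IsReducible Ax ψ) (hφ : IsReducible Ax φ) : IsReducible Ax (box G P Ψ φ) := by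
  induction G generalizing P Ψ φ with
  | atom g => exact box_atom hAx g P hΨ hφ
  | add G H ihG ihH =>
    have hs := splitBox hAx (G := G) (H := H) (P := P) (Ψ := Ψ) (φ := φ)
      (fun Ψ' h => ihG P (fun ψ hψ => hΨ ψ (h hψ)) hφ)
      (fun Ψ' h => ihH P (fun ψ hψ => hΨ ψ (h hψ)) hφ)
    cases P
    · exact of_recursionAxiom hAx hRec (.add_alice G H Ψ φ)
        (or hAx (or hAx (ihG _ hΨ hφ) (ihH _ hΨ hφ)) hs)
    · exact of_recursionAxiom hAx hRec (.add_bob G H Ψ φ) hs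
  | mul G H ihG ihH =>
    have hs := splitBox hAx (G := G) (H := H) (P := P) (Ψ := Ψ) (φ := φ)
      (fun Ψ' h => ihG P (fun ψ hψ => hΨ ψ (h hψ)) hφ)
      (fun Ψ' h => ihH P (fun ψ hψ => hΨ ψ (h hψ)) hφ)
    cases P
    · exact of_recursionAxiom hAx hRec (.mul_alice G H Ψ φ) hs
    · exact of_recursionAxiom hAx hRec (.mul_bob G H Ψ φ)
        (or hAx (or hAx (ihG _ hΨ hφ) (ihH _ hΨ hφ)) hs)
  | dual G ih => exact of_recursionAxiom hAx hRec (.dual G P Ψ φ) (ih _ hΨ hφ)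
  | comp G H ihG ihH =>
    refine of_recursionAxiom hAx hRec (.comp G H P Ψ φ) (ihG P (fun χ hχ => ?_)
      (ihH P (by simp) hφ))
    obtain ⟨ψ, hψ, rfl⟩ := List.mem_map.1 hχ
    exact ihH P (by simpa using hΨ ψ hψ) hφ

theorem all : ∀ φ : Formula Prp Gm, IsReducible Ax φ
  | .var p => of_isAtomic hAx ⟨{p}, ∅, 0, Set.finite_singleton p, Set.finite_empty, .var rfl⟩
  | .bot => of_isAtomic hAx ⟨∅, ∅, 0, Set.finite_empty, Set.finite_empty, .bot⟩
  | .neg φ => neg hAx (all φ)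
  | .and φ ψ => and hAx (all φ) (all ψ)
  | .box G P Ψ φ => box hAx hRec G P (fun ψ _ => all ψ) (all φ)

end IsReducible

end Reduction

/-! ### Finite sets of types -/

section Types

variable {Prp : Type u} {Gm : Type v} {Ax : Formula Prp Gm → Prop} {L : List (Formula Prp Gm)}

/-- The consistent types over the finite list `L` of formulas: the sets of (positions of) members of
`L` that are true under some model of the logic. -/
def Ty (Ax : Formula Prp Gm → Prop) (L : List (Formula Prp Gm)) : Type :=
  {s : Set (Fin L.length) // ∃ t, IsModelOf Ax t ∧ ∀ i, t (L.get i) ↔ i ∈ s}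

noncomputable instance : Fintype (Ty Ax L) :=
  @Fintype.ofFinite _ (Subtype.finite)

namespace Ty

/-- The type of an assignment. -/
def of (L : List (Formula Prp Gm)) (t : Formula Prp Gm → Prop) (ht : IsModelOf Ax t) : Ty Ax L :=
  ⟨{i | t (L.get i)}, t, ht, fun _ => Iff.rfl⟩

/-- An assignment that realizes a type. -/
noncomputable def val (c : Ty Ax L) : Formula Prp Gm → Prop := c.2.choose

theorem isModelOf_val (c : Ty Ax L) : IsModelOf Ax c.val := c.2.choose_spec.1

theorem of_eq_iff {t : Formula Prp Gm → Prop} (ht : IsModelOf Ax t) (c : Ty Ax L) :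
    of L t ht = c ↔ ∀ φ ∈ L, t φ ↔ c.val φ := by
  rw [List.forall_mem_iff_forall_getElem]
  refine Subtype.ext_iff.trans (Set.ext_iff.trans (Fin.forall_iff.trans ?_))
  refine forall₂_congr fun i hi => ?_
  rw [← c.2.choose_spec.2 ⟨i, hi⟩]
  exact Iff.rfl

theorem val_of {t : Formula Prp Gm → Prop} (ht : IsModelOf Ax t) {φ : Formula Prp Gm}
    (hφ : φ ∈ L) : (of L t ht).val φ ↔ t φ :=
  ((of_eq_iff ht _).1 rfl φ hφ).symm

open Classical in
/-- The characteristic formula of a type. -/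
noncomputable def char (c : Ty Ax L) : Formula Prp Gm :=
  (L.map fun φ => if c.val φ then φ else neg φ).foldr and top

theorem char_iff {t : Formula Prp Gm → Prop} (ht : IsModelOf Ax t) (c : Ty Ax L) :
    t c.char ↔ of L t ht = c := by
  rw [of_eq_iff, char, ht.foldr_and, List.forall_mem_map]
  refine forall₂_congr fun φ _ => ?_
  split_ifs with h
  · simp [h]
  · simp [h, ht.neg]

open Classical in
/-- The characteristic formulas of the members of a set of types. -/
noncomputable def chars (S : Set (Ty Ax L)) : List (Formula Prp Gm) :=
  (Finset.univ.filter (· ∈ S)).toList.map char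

theorem mem_chars {S : Set (Ty Ax L)} {φ : Formula Prp Gm} : φ ∈ chars S ↔ ∃ c ∈ S, c.char = φ := by
  simp [chars]

theorem disj_chars_iff {t : Formula Prp Gm → Prop} (ht : IsModelOf Ax t) (S : Set (Ty Ax L)) :
    t (disj (chars S)) ↔ of L t ht ∈ S := by
  simp [ht.disj, mem_chars, char_iff ht]

/-- The formula stating that `S` is the set of the types of the worlds in some basic power. -/
noncomputable def nabla (G : Game Gm) (P : Player) (S : Set (Ty Ax L)) : Formula Prp Gm :=
  box G P (chars S) (disj (chars S))

variable (hAx : ∀ φ, BaseAxiom φ → Ax φ) {t : Formula Prp Gm → Prop} (ht : IsModelOf Ax t)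
  {G : Game Gm} {P : Player} {Ψ : List (Formula Prp Gm)} {φ : Formula Prp Gm}
include hAx ht

/-- (Lem) is applied to the characteristic formula of each type in turn: either the type is added to
the list of required witnesses, or it is excluded from the power. -/
theorem exists_nabla (h : t (box G P Ψ φ)) : ∃ S : Set (Ty Ax L), t (nabla G P S) ∧
    (∀ c ∈ S, ∃ s, ∃ hs : IsModelOf Ax s, of L s hs = c ∧ s φ) ∧
    ∀ ψ ∈ Ψ, ∃ s, ∃ hs : IsModelOf Ax s, of L s hs ∈ S ∧ s ψ := by
  -- Invariant after treating the types in `l`: those collected in `S` are required by `Ψ'`, and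
  -- `φ'` excludes the other types in `l`.
  have key : ∀ l : List (Ty Ax L), ∃ (S : Set (Ty Ax L)) (Ψ' : List (Formula Prp Gm))
      (φ' : Formula Prp Gm), t (box G P Ψ' φ') ∧ Ψ ⊆ Ψ' ∧ (∀ c ∈ S, c.char ∈ Ψ') ∧
      ∀ s, ∀ hs : IsModelOf Ax s, s φ' → s φ ∧ (of L s hs ∈ l → of L s hs ∈ S) := by
    intro l
    induction l with
    | nil => exact ⟨∅, Ψ, φ, h, fun _ => id, by simp, fun s hs h => ⟨h, by simp⟩⟩
    | cons c l ih =>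
      obtain ⟨S, Ψ', φ', h', hΨ, hS, hφ⟩ := ih
      rcases (ht.or _ _).1 ((ht.imp _ _).1 (ht.base hAx (.lem G P Ψ' φ' c.char)) h') with h' | h'
      · refine ⟨insert c S, Ψ' ++ [c.char], φ', h', fun ψ hψ => by simp [hΨ hψ], ?_,
          fun s hs hsφ => ⟨(hφ s hs hsφ).1, fun hl => ?_⟩⟩
        · rintro d (rfl | hd)
          · simp
          · simp [hS d hd]
        · rcases List.mem_cons.1 hl with rfl | hl
          · exact Or.inl rfl
          · exact Or.inr ((hφ s hs hsφ).2 hl)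
      · refine ⟨S, Ψ', _, h', hΨ, hS, fun s hs hsφ => ?_⟩
        rw [hs.and, hs.neg, char_iff hs] at hsφ
        refine ⟨(hφ s hs hsφ.1).1, fun hl => ?_⟩
        exact (hφ s hs hsφ.1).2 ((List.mem_cons.1 hl).resolve_left hsφ.2)
  obtain ⟨S, Ψ', φ', h', hΨ, hS, hφ⟩ := key Finset.univ.toList
  simp only [Finset.mem_toList, Finset.mem_univ, true_imp_iff] at hφ
  refine ⟨S, ht.box_mono hAx h' (fun ψ hψ => ?_) fun s hs hsφ =>
    (disj_chars_iff hs S).2 (hφ s hs hsφ).2, fun c hc => ?_, fun ψ hψ => ?_⟩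
  · obtain ⟨c, hc, rfl⟩ := mem_chars.1 hψ
    exact ⟨_, hS c hc, fun _ _ => id⟩
  · obtain ⟨s, hs, hsc, hsφ⟩ := ht.box_consistent hAx h' (hS c hc)
    exact ⟨s, hs, (char_iff hs c).1 hsc, (hφ s hs hsφ).1⟩
  · obtain ⟨s, hs, hsψ, hsφ⟩ := ht.box_consistent hAx h' (hΨ hψ)
    exact ⟨s, hs, (hφ s hs hsφ).2, hsψ⟩

theorem box_of_nabla {S : Set (Ty Ax L)} (h : t (nabla G P S))
    (hφ : ∀ s, ∀ hs : IsModelOf Ax s, of L s hs ∈ S → s φ)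
    (hΨ : ∀ ψ ∈ Ψ, ∃ c ∈ S, ∀ s, ∀ hs : IsModelOf Ax s, of L s hs = c → s ψ) :
    t (box G P Ψ φ) := by
  refine ht.box_mono hAx h (fun ψ hψ => ?_) fun s hs h => hφ s hs ((disj_chars_iff hs S).1 h)
  obtain ⟨c, hc, h⟩ := hΨ ψ hψ
  exact ⟨c.char, mem_chars.2 ⟨c, hc, rfl⟩, fun s hs hsc => h s hs ((char_iff hs c).1 hsc)⟩

theorem nabla_nonempty (G : Game Gm) (P : Player) : ∃ S : Set (Ty Ax L), t (nabla G P S) :=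
  let ⟨S, h, _⟩ := exists_nabla hAx ht (ht.base hAx (.nonEm G P))
  ⟨S, h⟩

/-- (Inst) for the characteristic formula of `c`, followed by `exists_nabla` for the opponent. -/
theorem nabla_instantiated {S : Set (Ty Ax L)} (h : t (nabla G P S)) {c : Ty Ax L} (hc : c ∈ S) :
    ∃ S' : Set (Ty Ax L), t (nabla G P.other S') ∧ c ∈ S' := by
  have h₁ : t (box G P [c.char] top) := box_of_nabla hAx ht h (fun s hs _ => hs.top)
    (by simpa using ⟨c, hc, fun s hs h => (char_iff hs c).2 h⟩)
  obtain ⟨S', h', -, hS'⟩ := exists_nabla (L := L) hAx ht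
    (((ht.iff _ _).1 (ht.base hAx (.inst G P c.char))).1 h₁)
  obtain ⟨s, hs, hsS, hsc⟩ := hS' _ (List.mem_singleton_self _)
  exact ⟨S', h', (char_iff hs c).1 hsc ▸ hsS⟩

/-- If `S` and `S'` were disjoint, `disj (chars S')` would imply the negation of `disj (chars S)`,
against (Cons). -/
theorem nabla_consistent {S S' : Set (Ty Ax L)} (h : t (nabla G P S))
    (h' : t (nabla G P.other S')) : (S ∩ S').Nonempty := by
  by_contra hn
  have h₁ : t (box G P [] (disj (chars S))) := ht.box_weak hAx h (List.nil_subset _)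
  refine (ht.neg _).1 ((ht.imp _ _).1 (ht.base hAx (.cons G P _)) h₁)
    (box_of_nabla hAx ht h' (fun s hs hsS => ?_) (by simp))
  rw [hs.neg, disj_chars_iff hs]
  exact fun hsS' => hn ⟨_, hsS', hsS⟩

theorem nabla_union (hU : ∀ φ, UnionAxiom φ → Ax φ) {S S' : Set (Ty Ax L)} (h : t (nabla G P S))
    (h' : t (nabla G P S')) : t (nabla G P (S ∪ S')) := by
  have h₁ : t (box G P (chars S) (disj (chars (S ∪ S')))) :=
    ht.box_mono hAx h (fun ψ hψ => ⟨ψ, hψ, fun _ _ => id⟩) fun s hs => by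
      rw [disj_chars_iff hs, disj_chars_iff hs]; exact Or.inl
  have h₂ : t (box G P (chars S') (disj (chars (S ∪ S')))) :=
    ht.box_mono hAx h' (fun ψ hψ => ⟨ψ, hψ, fun _ _ => id⟩) fun s hs => by
      rw [disj_chars_iff hs, disj_chars_iff hs]; exact Or.inr
  refine ht.box_weak hAx ((ht.imp _ _).1 (ht.provable _ (.ax (hU _ (.union G P _ _ _))))
    ((ht.and _ _).2 ⟨h₁, h₂⟩)) fun ψ hψ => ?_
  obtain ⟨c, hc | hc, rfl⟩ := mem_chars.1 hψ
  · exact List.mem_append.2 (Or.inl (mem_chars.2 ⟨c, hc, rfl⟩))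
  · exact List.mem_append.2 (Or.inr (mem_chars.2 ⟨c, hc, rfl⟩))

/-- There are only finitely many sets of types, so the binary axiom yields all non-empty unions. -/
theorem nabla_sUnion (hU : ∀ φ, UnionAxiom φ → Ax φ) {F : Set (Set (Ty Ax L))} (hF : F.Nonempty)
    (h : ∀ S ∈ F, t (nabla G P S)) : t (nabla G P (⋃₀ F)) := by
  have hfin : F.Finite := Set.toFinite F
  induction F, hfin using Set.Finite.induction_on with
  | empty => simp at hF
  | @insert S F _ _ ih =>
    rw [Set.sUnion_insert]
    rcases F.eq_empty_or_nonempty with rfl | hF'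
    · simpa using h S (Set.mem_insert _ _)
    · exact nabla_union hAx ht hU (h S (Set.mem_insert _ _))
        (ih hF' fun S hS => h S (Set.mem_insert_of_mem _ hS))

end Ty

end Types

/-! ### The levelled canonical model -/

section Canonical

variable {Prp : Type u} {Gm : Type v} {Ax : Formula Prp Gm → Prop}
  {ps : List Prp} {gs : List Gm}

/-- The formulas that describe a world of level `n`: the variables in `ps` and, for the atomic games
in `gs`, the basic powers in terms of the types of the level below. -/
noncomputable def levelFormulas (Ax : Formula Prp Gm → Prop) (ps : List Prp) (gs : List Gm) :
    ℕ → List (Formula Prp Gm)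
  | 0 => ps.map var
  | n + 1 => ps.map var ++ gs.flatMap fun g => [Player.alice, Player.bob].flatMap fun P =>
      (Finset.univ : Finset (Set (Ty Ax (levelFormulas Ax ps gs n)))).toList.map fun S =>
        Ty.nabla (.atom g) P S

theorem var_mem_levelFormulas {p : Prp} (hp : p ∈ ps) (n : ℕ) :
    var p ∈ levelFormulas Ax ps gs n := by
  cases n <;> simp [levelFormulas, hp]

theorem nabla_mem_levelFormulas {g : Gm} (hg : g ∈ gs) (P : Player) {n : ℕ}
    (S : Set (Ty Ax (levelFormulas Ax ps gs n))) :
    Ty.nabla (.atom g) P S ∈ levelFormulas Ax ps gs (n + 1) := by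
  simp only [levelFormulas, List.mem_append, List.mem_flatMap, List.mem_map, Finset.mem_toList,
    Finset.mem_univ, true_and]
  exact Or.inr ⟨g, hg, P, by cases P <;> simp, S, rfl⟩

/-- The worlds of the canonical model. -/
structure World (Ax : Formula Prp Gm → Prop) (ps : List Prp) (gs : List Gm) : Type w where
  /-- the level of a world -/
  level : ℕ
  /-- the type of a world -/
  type : Ty Ax (levelFormulas Ax ps gs level)

/-- The canonical model: the basic powers at a world of level `n + 1` are sets of worlds of
level `n`. -/
def canonicalModel (hAx : ∀ φ, BaseAxiom φ → Ax φ) (ps : List Prp) (gs : List Gm) :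
    Model Prp Gm (World.{u, v, w} Ax ps gs) where
  -- At level 0 the truncated subtraction leaves the powers inside level 0. They are read off the
  -- assignment `val` merely to satisfy the conditions on models; the truth lemma never evaluates a
  -- modality there.
  R g P x := {Z | ∃ S, x.type.val (Ty.nabla (.atom g) P S) ∧ World.mk (x.level - 1) '' S = Z}
  V p := {x | x.type.val (var p)}
  nonemptiness g P x :=
    let ⟨S, hS⟩ := Ty.nabla_nonempty hAx x.type.isModelOf_val (.atom g) P
    ⟨_, S, hS, rfl⟩
  instantiatedness g P x := by
    rintro _ ⟨S, hS, rfl⟩ _ ⟨c, hc, rfl⟩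
    obtain ⟨S', hS', hc'⟩ := Ty.nabla_instantiated hAx x.type.isModelOf_val hS hc
    exact ⟨_, ⟨S', hS', rfl⟩, c, hc', rfl⟩
  consistency g x := by
    rintro _ ⟨S, hS, rfl⟩ _ ⟨S', hS', rfl⟩
    obtain ⟨c, hc, hc'⟩ := Ty.nabla_consistent hAx x.type.isModelOf_val hS hS'
    exact ⟨_, ⟨c, hc, rfl⟩, c, hc', rfl⟩

theorem canonicalModel_unionClosed (hAx : ∀ φ, BaseAxiom φ → Ax φ) (hU : ∀ φ, UnionAxiom φ → Ax φ)
    (ps : List Prp) (gs : List Gm) :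
    (canonicalModel.{u, v, w} hAx ps gs).UnionClosed := by
  intro g P x F hF hne
  -- The members of `F` are pulled back to sets of types; taking images commutes with unions.
  refine ⟨⋃₀ {S | x.type.val (Ty.nabla (.atom g) P S) ∧ World.mk (x.level - 1) '' S ∈ F},
    Ty.nabla_sUnion hAx x.type.isModelOf_val hU ?_ fun S hS => hS.1, ?_⟩
  · obtain ⟨Z, hZ⟩ := hne
    obtain ⟨S, hS, rfl⟩ := hF hZ
    exact ⟨S, hS, hZ⟩
  · ext y
    constructor
    · rintro ⟨c, ⟨S, hS, hc⟩, rfl⟩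
      exact ⟨_, hS.2, c, hc, rfl⟩
    · rintro ⟨Z, hZ, hy⟩
      obtain ⟨S, hS, rfl⟩ := hF hZ
      obtain ⟨c, hc, rfl⟩ := hy
      exact ⟨c, ⟨S, ⟨hS, hZ⟩, hc⟩, rfl⟩

/-- In the modal case the type at level `n + 1` decides all `nabla` formulas over level `n`. By the
induction hypothesis, all assignments of one type agree on the arguments, so `box_of_nabla` and
`exists_nabla` give the two directions. -/
theorem canonicalModel_truth (hAx : ∀ φ, BaseAxiom φ → Ax φ) {n : ℕ} {φ : Formula Prp Gm}
    (hφ : InFragment {p | p ∈ ps} {g | g ∈ gs} n φ) {t : Formula Prp Gm → Prop}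
    (ht : IsModelOf Ax t) :
    World.mk n (Ty.of _ t ht) ∈ (canonicalModel.{u, v, w} hAx ps gs).truth φ ↔ t φ := by
  induction hφ generalizing t with
  | var hp =>
    simp only [Model.truth]
    exact Ty.val_of ht (var_mem_levelFormulas hp _)
  | bot => simpa [Model.truth] using ht.bot
  | neg _ ih => rw [ht.neg, ← ih ht]; simp [Model.truth]
  | and _ _ ih₁ ih₂ => rw [ht.and, ← ih₁ ht, ← ih₂ ht]; simp [Model.truth]
  | @box n g P Ψ φ hg _ _ ihΨ ih =>
    rw [Model.mem_truth_box]
    constructor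
    · rintro ⟨_, ⟨S, hS, rfl⟩, hφ, hΨ⟩
      replace hS := (Ty.val_of ht (nabla_mem_levelFormulas hg P S)).1 hS
      refine Ty.box_of_nabla hAx ht hS (fun s hs h => (ih hs).1 (hφ ⟨_, h, rfl⟩)) fun ψ hψ => ?_
      obtain ⟨_, ⟨c, hc, rfl⟩, hcψ⟩ := hΨ ψ hψ
      exact ⟨c, hc, fun s hs h => (ihΨ ψ hψ hs).1 (h ▸ hcψ)⟩
    · intro h
      obtain ⟨S, hS, hφ, hΨ⟩ := Ty.exists_nabla (L := levelFormulas Ax ps gs n) hAx ht h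
      refine ⟨_, ⟨S, (Ty.val_of ht (nabla_mem_levelFormulas hg P S)).2 hS, rfl⟩, ?_, fun ψ hψ => ?_⟩
      · rintro _ ⟨c, hc, rfl⟩
        obtain ⟨s, hs, rfl, hsφ⟩ := hφ c hc
        exact (ih hs).2 hsφ
      · obtain ⟨s, hs, hsS, hsψ⟩ := hΨ ψ hψ
        exact ⟨_, ⟨_, hsS, rfl⟩, (ihΨ ψ hψ hs).2 hsψ⟩

/-- A formula that is true in all canonical models is provable. -/
theorem Provable.of_canonicalModel (hAx : ∀ φ, BaseAxiom φ → Ax φ)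
    (hRec : ∀ φ, RecursionAxiom φ → Ax φ) {φ : Formula Prp Gm}
    (hsound : ∀ (ps : List Prp) (gs : List Gm), ∀ ψ, Provable Ax ψ →
      ∀ x, x ∈ (canonicalModel.{u, v, w} hAx ps gs).truth ψ)
    (h : ∀ (ps : List Prp) (gs : List Gm) (x), x ∈ (canonicalModel.{u, v, w} hAx ps gs).truth φ) :
    Provable Ax φ := by
  obtain ⟨φ', ⟨ps, gs, n, hps, hgs, hφ'⟩, hiff⟩ := IsReducible.all hAx hRec φ
  obtain ⟨ps, rfl⟩ : ∃ l : List Prp, {p | p ∈ l} = ps := ⟨hps.toFinset.toList, by ext; simp⟩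
  obtain ⟨gs, rfl⟩ : ∃ l : List Gm, {g | g ∈ l} = gs := ⟨hgs.toFinset.toList, by ext; simp⟩
  refine .of_forall_isModelOf hAx fun t ht => ?_
  rw [(provable_iff_iff hAx).1 hiff t ht, ← canonicalModel_truth.{u, v, w} hAx hφ' ht]
  -- Soundness for the canonical model transfers truth from `φ` to its reduct `φ'`.
  exact (((Model.isBoolean_truth _ _).iff _ _).1 (hsound ps gs _ hiff _)).1 (h ps gs _)

end Canonical

end DynamicGameLogic

theorem mainTheorem10 {Prp : Type u} {Gm : Type v} (φ : DynamicGameLogic.Formula Prp Gm) :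
    (DynamicGameLogic.Provable DynamicGameLogic.RelDynAxiom φ ↔
      DynamicGameLogic.RelValid.{u, v, w} φ) ∧
    (DynamicGameLogic.Provable DynamicGameLogic.DynAxiom φ ↔
      DynamicGameLogic.Valid.{u, v, w} φ) := by
  open DynamicGameLogic in
  refine ⟨⟨Provable.relValid, fun h => ?_⟩, Provable.valid, fun h => ?_⟩
  -- The Union axiom makes the canonical models union closed, so both the validity hypothesis and
  -- relational soundness apply to them.
  · have hU := fun ps gs => canonicalModel_unionClosed.{u, v, w} (Prp := Prp) (Gm := Gm)
      (Ax := RelDynAxiom) (fun _ h => .inl (.inl h)) (fun _ h => .inr h) ps gs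
    exact .of_canonicalModel (fun _ h => .inl (.inl h)) (fun _ h => .inl (.inr h))
      (fun ps gs _ hψ => hψ.relValid _ _ (hU ps gs)) fun ps gs => h _ _ (hU ps gs)
  · exact .of_canonicalModel (fun _ h => .inl h) (fun _ h => .inr h)
      (fun _ _ _ hψ => hψ.valid _ _) fun _ _ => h _ _
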